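/- Let $r,c\ge 1$, let $\bm p=(p_{11},\dots,p_{1c},p_{21},\dots,p_{rc})^\top$ be a vector of cell probabilities ($p_{ij}\ge 0$, $\sum_{i,j}p_{ij}=1$), and for each sample size $n$ let $(n_{ij})$ be a random $r\times c$ table of counts having the multinomial distribution with $n$ trials and cell probabilities $\bm p$. For $\alpha\ge 0$ let $\hat{\bm p}^{(\alpha)}$ be the vector with entries $\hat p^{(\alpha)}_{ij}=\dfrac{n_{ij}+\alpha}{n+rc\,\alpha}$, which for $\alpha>0$ is the posterior mean of $\bm p$ under the Dirichlet$(\alpha,\dots,\alpha)$ prior and for $\alpha=0$ is the vector of sample proportions. Let $f:\mathbb R^{rc}\to\mathbb R$ be four times differentiable at $\bm p$ (its derivatives up to order three exist in a neighbourhood of $\bm p$, and the third derivative is differentiable at $\bm p$). Write $\bm g=\partial f(\bm p)/\partial\bm p$ for the gradient and $\bm H=\partial^2 f(\bm p)/\partial\bm p\,\partial\bm p^\top$ for the Hessian of $f$ at $\bm p$, $\bm v=rc\,\bm p-\bm 1_{rc}$, where $\bm 1_{rc}$ is the vector of ones, $\bm\Sigma=\mathrm{diag}(\bm p)-\bm p\bm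 p^\top$, and $$A_1=\mathrm{tr}\left[\bm g\bm g^\top\bm v\bm v^\top\right],\qquad A_2=\tfrac12\,\bm v^\top\bm g\;\mathrm{tr}\left[\bm H\bm\Sigma\right]+rc\,\mathrm{tr}\left[\bm g\bm g^\top\bm\Sigma\right]+\mathrm{tr}\left[\bm g\bm v^\top\bm H\bm\Sigma\right].$$ Then there is a sequence $B(n)$ that does not depend on $\alpha$ such that, for every fixed $\alpha\ge 0$ for which the values of $f(\hat{\bm p}^{(\alpha)})$ grow subexponentially, i.e. $\max|f(\hat{\bm p}^{(\alpha)})|\le e^{o(n)}$ with the maximum over all tables of $n$ observations (in particular for every $\alpha\ge 0$ if $f$ is bounded on the probability simplex), $$\mathrm{MSE}\left[f(\hat{\bm p}^{(\alpha)})\right]=\mathrm E\left[\left(f(\hat{\bm p}^{(\alpha)})-f(\bm p)\right)^2\right]=\frac1{n^2}\left(A_1\alpha^2-2A_2\alpha\right)+B(n)+o(n^{-2})\qquad(n\to\infty).$$ -/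

import Mathlib

open MeasureTheory ProbabilityTheory Filter Topology Asymptotics
open scoped Matrix

noncomputable section

namespace ContingencyTable

/-- The multinomial distribution with `n` trials and cell probabilities `p`, as a measure on count
vectors: the vector `x` with `∑ t, x t = n` has mass `n! / ∏ t, (x t)! * ∏ t, p t ^ x t`. -/
def multinomialMeasure {ι : Type*} [Fintype ι] [DecidableEq ι] (n : ℕ) (p : ι → ℝ) :
    Measure (ι → ℕ) :=
  ∑ x ∈ (Finset.univ : Finset ι).piAntidiag n,
    ENNReal.ofReal ((Nat.multinomial Finset.univ x : ℝ) * ∏ t, p t ^ x t) • Measure.dirac x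

/-- The posterior mean of the cell probabilities of an `r × c` table under the symmetric Dirichlet
prior with parameter `α`, given the counts `x`. For `α = 0` it is the sample proportion. -/
def posteriorMean {r c : ℕ} (α : ℝ) (x : Fin r × Fin c → ℕ) : Fin r × Fin c → ℝ :=
  fun t => ((x t : ℝ) + α) / (((∑ s, x s : ℕ) : ℝ) + (r : ℝ) * (c : ℝ) * α)

/-- `f` is `k` times (Fréchet) differentiable at `p`: the derivatives of order less than `k` are
differentiable at `p`, those of order less than `k - 1` also at all points near `p`. -/
def TimesDifferentiableAt {E : Type*} [NormedAddCommGroup E] [NormedSpace ℝ E]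
    (k : ℕ) (f : E → ℝ) (p : E) : Prop :=
  ∀ m < k, DifferentiableAt ℝ (iteratedFDeriv ℝ m f) p ∧
    (m + 1 < k → ∀ᶠ q in 𝓝 p, DifferentiableAt ℝ (iteratedFDeriv ℝ m f) q)

/-- The gradient `∂f/∂p`, the column vector of first order partial derivatives. -/
def grad {ι : Type*} [Fintype ι] [DecidableEq ι] (f : (ι → ℝ) → ℝ) (p : ι → ℝ) : ι → ℝ :=
  fun i => fderiv ℝ f p (Pi.single i 1)

/-- The Hessian `∂²f/∂p∂pᵀ`, the matrix of second order partial derivatives. -/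
def hess {ι : Type*} [Fintype ι] [DecidableEq ι] (f : (ι → ℝ) → ℝ) (p : ι → ℝ) : Matrix ι ι ℝ :=
  Matrix.of fun i j => fderiv ℝ (fun q => fderiv ℝ f q (Pi.single j 1)) p (Pi.single i 1)

/-- The matrix `diag(p) - p pᵀ`. -/
def cov {ι : Type*} [DecidableEq ι] (p : ι → ℝ) : Matrix ι ι ℝ :=
  Matrix.diagonal p - Matrix.vecMulVec p p

/-- The vector `rc p - 1`. -/
def shift {r c : ℕ} (p : Fin r × Fin c → ℝ) : Fin r × Fin c → ℝ :=
  fun t => (r : ℝ) * (c : ℝ) * p t - 1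

/-- `A₁ = tr[(∂f/∂p)(∂f/∂pᵀ)(rc p - 1)(rc p - 1)ᵀ]`. -/
def A₁ {r c : ℕ} (f : (Fin r × Fin c → ℝ) → ℝ) (p : Fin r × Fin c → ℝ) : ℝ :=
  (Matrix.vecMulVec (grad f p) (grad f p) * Matrix.vecMulVec (shift p) (shift p)).trace

/-- `A₂ = (1/2) (rc p - 1)ᵀ(∂f/∂p) tr[H Σ] + rc tr[(∂f/∂p)(∂f/∂pᵀ) Σ]
+ tr[(∂f/∂p)(rc p - 1)ᵀ H Σ]`, with `H` the Hessian of `f` at `p` and `Σ = diag(p) - p pᵀ`. -/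
def A₂ {r c : ℕ} (f : (Fin r × Fin c → ℝ) → ℝ) (p : Fin r × Fin c → ℝ) : ℝ :=
  1 / 2 * (shift p ⬝ᵥ grad f p) * (hess f p * cov p).trace
    + (r : ℝ) * (c : ℝ) * (Matrix.vecMulVec (grad f p) (grad f p) * cov p).trace
    + (Matrix.vecMulVec (grad f p) (shift p) * hess f p * cov p).trace

/-- The plug-in values `f (posteriorMean α x)` grow subexponentially in the sample size:
their maximum over all tables `x` with `n` observations is `exp (o(n))`. This holds for
every `α ≥ 0` if `f` is bounded on the probability simplex. -/
def SubexponentialAt {r c : ℕ} (f : (Fin r × Fin c → ℝ) → ℝ) (α : ℝ) : Prop :=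
  ∀ ε > 0, ∀ᶠ n : ℕ in atTop, ∀ x : Fin r × Fin c → ℕ, ∑ t, x t = n →
    |f (posteriorMean α x)| ≤ Real.exp (ε * n)

/-- The mean squared error `E[(f(p̂^(α)) - f(p))²]` for the random count vector `N`. -/
def mse {Ω : Type*} [MeasurableSpace Ω] (P : Measure Ω) {r c : ℕ} (N : Ω → Fin r × Fin c → ℕ)
    (f : (Fin r × Fin c → ℝ) → ℝ) (p : Fin r × Fin c → ℝ) (α : ℝ) : ℝ :=
  ∫ ω, (f (posteriorMean α (N ω)) - f p) ^ 2 ∂P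

end ContingencyTable

end

/-! The estimators for a given `α` and for `α = 0` are compared pointwise before any expectation is
taken. With `z` the deviation of the sample proportions from `p` and `a = 1/n`, the posterior mean
is `p + (1 + rcα a)⁻¹ (z - α a v)`, an `O(a)` perturbation of `p + z` (`posteriorMean_eq`). A second
order Taylor expansion shows that the squared errors at these two points differ by an explicit
polynomial in `z` and `a`, up to `o(a (‖z‖² + a))` (`isLittleO_sq_error_sub`). Comparing differences
is what makes two derivatives enough: the α-free part of the MSE is never expanded and goes into
`B`.

The polynomial has degree at most two in `z`, so its mean follows exactly from the first two
multinomial moments. Its one term of size `a ‖z‖`, too large to be an error, is linear in `z` and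
has mean zero; the rest gives `A₁` and `A₂`. Since `E‖z‖² = O(1/n)`, the error has mean `o(n⁻²)`.

Outside a small ball the Chernoff bound `multinomialExp_tail` decays exponentially and beats the
subexponential growth of `f`. As no growth is assumed at `α = 0`, `B` is the `α = 0` error truncated
to a ball on which `f` is bounded. -/

namespace ContingencyTable

/-! ### Moments and concentration of the multinomial distribution -/

section Multinomial

variable {ι : Type*} [Fintype ι] [DecidableEq ι]

/-- The expectation of `F` under the multinomial distribution, as a finite sum. -/
noncomputable def multinomialExp (n : ℕ) (p : ι → ℝ) (F : (ι → ℕ) → ℝ) : ℝ :=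
  ∑ x ∈ (Finset.univ : Finset ι).piAntidiag n,
    ((Nat.multinomial Finset.univ x : ℝ) * ∏ t, p t ^ x t) * F x

theorem integral_multinomialMeasure {n : ℕ} {p : ι → ℝ} (hp : ∀ t, 0 ≤ p t)
    (F : (ι → ℕ) → ℝ) :
    ∫ x, F x ∂(multinomialMeasure n p) = multinomialExp n p F := by
  unfold multinomialMeasure multinomialExp
  rw [integral_finsetSum_measure]
  · refine Finset.sum_congr rfl fun x _ => ?_
    rw [integral_smul_measure, integral_dirac, smul_eq_mul, ENNReal.toReal_ofReal]
    exact mul_nonneg (Nat.cast_nonneg _) (Finset.prod_nonneg fun t _ => pow_nonneg (hp t) _)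
  · intro x _
    exact (integrable_dirac (by finiteness)).smul_measure ENNReal.ofReal_ne_top

variable {n : ℕ} {p : ι → ℝ}

theorem multinomialExp_mono (hp : ∀ t, 0 ≤ p t) {F G : (ι → ℕ) → ℝ}
    (h : ∀ x : ι → ℕ, ∑ t, x t = n → F x ≤ G x) :
    multinomialExp n p F ≤ multinomialExp n p G := by
  refine Finset.sum_le_sum fun x hx => mul_le_mul_of_nonneg_left (h x ?_) ?_
  · exact (Finset.mem_piAntidiag.1 hx).1
  · exact mul_nonneg (Nat.cast_nonneg _) (Finset.prod_nonneg fun t _ => pow_nonneg (hp t) _)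

theorem multinomialExp_congr {F G : (ι → ℕ) → ℝ}
    (h : ∀ x : ι → ℕ, ∑ t, x t = n → F x = G x) :
    multinomialExp n p F = multinomialExp n p G :=
  Finset.sum_congr rfl fun x hx => by rw [h x (Finset.mem_piAntidiag.1 hx).1]

theorem multinomialExp_add (F G : (ι → ℕ) → ℝ) :
    multinomialExp n p (fun x => F x + G x) = multinomialExp n p F + multinomialExp n p G := by
  simp only [multinomialExp, mul_add, Finset.sum_add_distrib]

theorem multinomialExp_sub (F G : (ι → ℕ) → ℝ) :
    multinomialExp n p (fun x => F x - G x) = multinomialExp n p F - multinomialExp n p G := by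
  simp only [multinomialExp, mul_sub, Finset.sum_sub_distrib]

theorem multinomialExp_const_mul (a : ℝ) (F : (ι → ℕ) → ℝ) :
    multinomialExp n p (fun x => a * F x) = a * multinomialExp n p F := by
  simp only [multinomialExp, Finset.mul_sum]
  exact Finset.sum_congr rfl fun x _ => by ring

theorem multinomialExp_sum {κ : Type*} (s : Finset κ) (F : κ → (ι → ℕ) → ℝ) :
    multinomialExp n p (fun x => ∑ i ∈ s, F i x) = ∑ i ∈ s, multinomialExp n p (F i) := by
  simp only [multinomialExp, Finset.mul_sum]
  exact Finset.sum_comm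

theorem abs_multinomialExp_le (hp : ∀ t, 0 ≤ p t) (F : (ι → ℕ) → ℝ) :
    |multinomialExp n p F| ≤ multinomialExp n p fun x => |F x| := by
  refine (Finset.abs_sum_le_sum_abs _ _).trans (Finset.sum_le_sum fun x _ => ?_)
  rw [abs_mul, abs_of_nonneg]
  exact mul_nonneg (Nat.cast_nonneg _) (Finset.prod_nonneg fun t _ => pow_nonneg (hp t) _)

/-- The moment generating function of the multinomial distribution. -/
theorem multinomialExp_exp (a : ι → ℝ) :
    multinomialExp n p (fun x => Real.exp (∑ t, a t * x t)) =
      (∑ t, p t * Real.exp (a t)) ^ n := by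
  rw [Finset.sum_pow_eq_sum_piAntidiag]
  refine Finset.sum_congr rfl fun x _ => ?_
  simp only [Real.exp_sum]
  rw [mul_assoc, ← Finset.prod_mul_distrib]
  congr 1
  refine Finset.prod_congr rfl fun t _ => ?_
  rw [mul_pow, ← Real.exp_nat_mul, mul_comm (a t)]

theorem multinomialExp_const (hp : ∑ t, p t = 1) (a : ℝ) :
    multinomialExp n p (fun _ => a) = a := by
  have h := multinomialExp_exp (n := n) (p := p) 0
  simp only [Pi.zero_apply, zero_mul, Finset.sum_const_zero, Real.exp_zero, mul_one, hp,
    one_pow] at h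
  have := multinomialExp_const_mul (n := n) (p := p) a (fun _ => 1)
  rw [h] at this
  simpa using this

/-- The first two derivatives of the moment generating function in a direction. -/
theorem multinomialExp_linear_and_sq (hp : ∑ t, p t = 1) (a : ι → ℝ)
    (ha : ∑ t, p t * a t = 0) :
    multinomialExp n p (fun x => ∑ t, a t * x t) = 0 ∧
      multinomialExp n p (fun x => (∑ t, a t * x t) ^ 2) = n * ∑ t, p t * a t ^ 2 := by
  set S : (ι → ℕ) → ℝ := fun x => ∑ t, a t * x t with hS
  set M : (ι → ℕ) → ℝ := fun x => (Nat.multinomial Finset.univ x : ℝ) * ∏ t, p t ^ x t with hM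
  -- `ψ k` and `φ k` are the `k`-th derivatives of the one-trial and `n`-trial moment generating
  -- functions along `a`. Differentiating `φ 0 = ψ 0 ^ n` twice at `0` gives both moments.
  set ψ : ℕ → ℝ → ℝ := fun k θ => ∑ t, p t * (a t ^ k * Real.exp (θ * a t)) with hψ
  have hψd : ∀ k θ, HasDerivAt (ψ k) (ψ (k + 1) θ) θ := by
    intro k θ
    refine HasDerivAt.fun_sum fun t _ => ?_
    have h := ((((hasDerivAt_id θ).mul_const (a t)).exp).const_mul (a t ^ k)).const_mul (p t)
    refine h.congr_deriv ?_
    simp only [id]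
    ring
  set φ : ℕ → ℝ → ℝ := fun k θ => multinomialExp n p fun x => S x ^ k * Real.exp (θ * S x) with hφ
  have hφd : ∀ k θ, HasDerivAt (φ k) (φ (k + 1) θ) θ := by
    intro k θ
    refine HasDerivAt.fun_sum fun x _ => ?_
    have h := ((((hasDerivAt_id θ).mul_const (S x)).exp).const_mul (S x ^ k)).const_mul (M x)
    refine h.congr_deriv ?_
    simp only [id, hM]
    ring
  have hφ0 : φ 0 = fun θ => ψ 0 θ ^ n := by
    funext θ
    have h := multinomialExp_exp (n := n) (p := p) fun t => θ * a t
    simp only [hφ, hψ, hS, pow_zero, one_mul, Finset.mul_sum, mul_one, ← mul_assoc]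
    exact h
  have hφ1 : φ 1 = fun θ => n * ψ 0 θ ^ (n - 1) * ψ 1 θ := by
    funext θ
    refine (hφd 0 θ).unique ?_
    rw [hφ0]
    exact (hψd 0 θ).pow n
  -- The truncated subtractions are harmless: `ψ 1 0 = 0` removes the first summand and `ψ 0 0 = 1`.
  have hφ2 : φ 2 0 = (n * ((n - 1 : ℕ) * ψ 0 0 ^ (n - 1 - 1) * ψ 1 0)) * ψ 1 0
      + n * ψ 0 0 ^ (n - 1) * ψ 2 0 := by
    refine (hφd 1 0).unique ?_
    rw [hφ1]
    exact (((hψd 0 0).pow (n - 1)).const_mul (n : ℝ)).mul (hψd 1 0)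
  have e0 : ψ 0 0 = 1 := by simpa [hψ] using hp
  have e1 : ψ 1 0 = 0 := by simpa [hψ] using ha
  have e2 : ψ 2 0 = ∑ t, p t * a t ^ 2 := by simp [hψ]
  constructor
  · have h := congrFun hφ1 0
    simpa [e0, e1, hφ] using h
  · have h := hφ2
    rw [e0, e1, e2] at h
    simpa [hφ] using h

/-- The deviation of the sample proportions from the cell probabilities. -/
noncomputable def deviation (n : ℕ) (p : ι → ℝ) (x : ι → ℕ) : ι → ℝ := fun t => x t / n - p t

-- The counts sum to `n`, so subtracting the mean of `u` absorbs the centring; the new weights have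
-- mean zero, as the moment computation requires.
omit [DecidableEq ι] in
theorem sum_mul_deviation (hn : n ≠ 0) (u : ι → ℝ) {x : ι → ℕ} (hx : ∑ t, x t = n) :
    ∑ t, u t * deviation n p x t
      = (n : ℝ)⁻¹ * ∑ t, (u t - ∑ s, p s * u s) * x t := by
  have hn' : (n : ℝ) ≠ 0 := Nat.cast_ne_zero.2 hn
  have hx' : ∑ t, (x t : ℝ) = n := by exact_mod_cast hx
  simp only [sub_mul, Finset.sum_sub_distrib, ← Finset.mul_sum, hx', deviation, mul_sub]
  rw [mul_comm _ (n : ℝ), inv_mul_cancel_left₀ hn', Finset.mul_sum]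
  congr 1
  · exact Finset.sum_congr rfl fun t _ => by field_simp
  · exact Finset.sum_congr rfl fun t _ => mul_comm _ _

theorem multinomialExp_deviation_linear_and_sq (hp : ∑ t, p t = 1) (hn : n ≠ 0) (u : ι → ℝ) :
    multinomialExp n p (fun x => ∑ t, u t * deviation n p x t) = 0 ∧
      multinomialExp n p (fun x => (∑ t, u t * deviation n p x t) ^ 2) =
        (n : ℝ)⁻¹ * (∑ t, p t * u t ^ 2 - (∑ t, p t * u t) ^ 2) := by
  have hn' : (n : ℝ) ≠ 0 := Nat.cast_ne_zero.2 hn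
  set m := ∑ s, p s * u s with hm
  obtain ⟨h1, h2⟩ := multinomialExp_linear_and_sq (n := n) hp (fun t => u t - m) (by
    simp only [mul_sub, Finset.sum_sub_distrib, ← Finset.sum_mul, hp]
    rw [← hm]; ring)
  constructor
  · rw [multinomialExp_congr fun x hx => sum_mul_deviation hn u hx, multinomialExp_const_mul, h1,
      mul_zero]
  · rw [multinomialExp_congr fun x hx => by rw [sum_mul_deviation hn u hx, mul_pow],
      multinomialExp_const_mul, h2]
    have : ∑ t, p t * (u t - m) ^ 2 = ∑ t, p t * u t ^ 2 - m ^ 2 := by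
      have h : ∀ t, p t * (u t - m) ^ 2 = p t * u t ^ 2 - 2 * m * (p t * u t) + m ^ 2 * p t :=
        fun t => by ring
      simp only [h, Finset.sum_add_distrib, Finset.sum_sub_distrib, ← Finset.mul_sum, hp]
      rw [← hm]; ring
    rw [this]
    field_simp

theorem multinomialExp_deviation (hp : ∑ t, p t = 1) (hn : n ≠ 0) (i : ι) :
    multinomialExp n p (fun x => deviation n p x i) = 0 := by
  simpa [Pi.single_apply] using
    (multinomialExp_deviation_linear_and_sq hp hn (Pi.single i 1)).1

theorem multinomialExp_deviation_mul (hp : ∑ t, p t = 1) (hn : n ≠ 0) (i j : ι) :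
    multinomialExp n p (fun x => deviation n p x i * deviation n p x j) =
      (n : ℝ)⁻¹ * cov p i j := by
  have key : ∀ u : ι → ℝ, multinomialExp n p (fun x => (∑ t, u t * deviation n p x t) ^ 2) =
        (n : ℝ)⁻¹ * (∑ t, p t * u t ^ 2 - (∑ t, p t * u t) ^ 2) := fun u =>
    (multinomialExp_deviation_linear_and_sq hp hn u).2
  have hi := key (Pi.single i 1)
  have hj := key (Pi.single j 1)
  -- Polarization: the mixed moment is read off from the squares along `eᵢ`, `eⱼ` and `eᵢ + eⱼ`.
  have hij := key (Pi.single i 1 + Pi.single j 1)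
  simp only [Pi.add_apply, add_mul, Finset.sum_add_distrib, mul_add, add_sq] at hij
  simp only [Pi.single_apply, ite_mul, one_mul, zero_mul, Finset.sum_ite_eq', Finset.mem_univ,
    if_true, ite_pow, one_pow, mul_ite, mul_one, mul_zero, ne_eq, OfNat.ofNat_ne_zero,
    not_false_eq_true, zero_pow, multinomialExp_add, mul_assoc,
    multinomialExp_const_mul] at hi hj hij
  rw [cov, Matrix.sub_apply, Matrix.diagonal_apply, Matrix.vecMulVec_apply]
  rcases eq_or_ne i j with rfl | hne
  · simp only [← sq, if_true] at hi ⊢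
    exact hi
  · simp only [if_neg hne, if_neg hne.symm] at hij ⊢
    simp at hij
    linarith

/-- A Chernoff bound for one cell. -/
theorem multinomialExp_tail_apply (hp : p ∈ stdSimplex ℝ ι) (i : ι) (σ : ℝ) (hσ : |σ| = 1)
    {η : ℝ} (h0 : 0 ≤ η) (h1 : η ≤ 1) :
    multinomialExp n p (fun x => Real.exp (η / 2 * (σ * (x i - n * p i) - n * η))) ≤
      Real.exp (-(η ^ 2 / 4) * n) := by
  -- Centred weights with tilt `η / 2`. As `|a t| ≤ η / 2 ≤ 1`, `exp x ≤ 1 + x + x²` bounds the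
  -- one-trial factor by `exp (η² / 4)`, against a gain of `exp (-η² / 2)` per trial.
  set a : ι → ℝ := fun t => η / 2 * σ * ((if t = i then 1 else 0) - p i) with ha
  have hp1 : p i ≤ 1 := hp.2 ▸ Finset.single_le_sum (fun t _ => hp.1 t) (Finset.mem_univ i)
  have hb : ∀ t, |a t| ≤ η / 2 := by
    intro t
    rw [ha, abs_mul, abs_mul, hσ, mul_one, abs_of_nonneg (by positivity)]
    refine mul_le_of_le_one_right (by positivity) ?_
    rw [abs_le]
    split_ifs <;> constructor <;> linarith [hp.1 i]
  have hx : ∀ x : ι → ℕ, ∑ t, x t = n →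
      Real.exp (η / 2 * (σ * (x i - n * p i) - n * η)) =
        Real.exp (-(η ^ 2 / 2) * n) * Real.exp (∑ t, a t * x t) := by
    intro x hx
    have hx' : ∑ t, (x t : ℝ) = n := by exact_mod_cast hx
    have : ∑ t, a t * x t = η / 2 * σ * (x i - p i * n) := by
      rw [← hx']
      simp only [ha, mul_assoc, ← Finset.mul_sum, sub_mul, Finset.sum_sub_distrib, ite_mul,
        one_mul, zero_mul, Finset.sum_ite_eq', Finset.mem_univ, if_true]
    rw [this, ← Real.exp_add]
    congr 1
    ring
  have hm : ∑ t, p t * a t = 0 := by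
    have h : ∀ t, p t * a t = η / 2 * σ * ((if t = i then p t else 0) - p i * p t) := fun t => by
      simp only [ha]; split_ifs <;> ring
    simp only [h, ← Finset.mul_sum, Finset.sum_sub_distrib, Finset.sum_ite_eq', Finset.mem_univ,
      if_true, hp.2, mul_one, sub_self, mul_zero]
  have hψ : ∑ t, p t * Real.exp (a t) ≤ Real.exp (η ^ 2 / 4) := by
    calc ∑ t, p t * Real.exp (a t) ≤ ∑ t, (p t + p t * a t + p t * (η ^ 2 / 4)) := by
          refine Finset.sum_le_sum fun t _ => ?_
          have h2 := (abs_le.1 (Real.abs_exp_sub_one_sub_id_le (x := a t)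
            ((hb t).trans (by linarith)))).2
          have h3 : a t ^ 2 ≤ η ^ 2 / 4 := by
            rw [← sq_abs]
            calc |a t| ^ 2 ≤ (η / 2) ^ 2 := pow_le_pow_left₀ (abs_nonneg _) (hb t) 2
              _ = η ^ 2 / 4 := by ring
          have h4 : Real.exp (a t) ≤ 1 + a t + η ^ 2 / 4 := by linarith
          linarith [mul_le_mul_of_nonneg_left h4 (hp.1 t)]
      _ = η ^ 2 / 4 + 1 := by
          rw [Finset.sum_add_distrib, Finset.sum_add_distrib, ← Finset.sum_mul, hp.2, hm]
          ring
      _ ≤ _ := Real.add_one_le_exp _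
  rw [multinomialExp_congr hx, multinomialExp_const_mul, multinomialExp_exp]
  calc _ ≤ Real.exp (-(η ^ 2 / 2) * n) * Real.exp (η ^ 2 / 4) ^ n := by
        gcongr
        exact Finset.sum_nonneg fun t _ => mul_nonneg (hp.1 t) (Real.exp_pos _).le
    _ = _ := by
        rw [← Real.exp_nat_mul, ← Real.exp_add]
        congr 1
        ring

/-- The sample proportions concentrate exponentially fast. -/
theorem multinomialExp_tail (hp : p ∈ stdSimplex ℝ ι) (hn : n ≠ 0) {η : ℝ} (h0 : 0 < η)
    (h1 : η ≤ 1) :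
    multinomialExp n p (fun x => if ‖deviation n p x‖ < η then 0 else 1) ≤
      2 * Fintype.card ι * Real.exp (-(η ^ 2 / 4) * n) := by
  have hn' : (0 : ℝ) < n := by positivity
  -- Sup norm at least `η` means some coordinate is at least `η` in absolute value; its upper or
  -- lower exponential is then at least `1`.
  calc _ ≤ multinomialExp n p (fun x => ∑ i,
        (Real.exp (η / 2 * (1 * (x i - n * p i) - n * η)) +
          Real.exp (η / 2 * (-1 * (x i - n * p i) - n * η)))) := by
        refine multinomialExp_mono hp.1 fun x _ => ?_
        have hnn : ∀ i ∈ (Finset.univ : Finset ι),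
            0 ≤ Real.exp (η / 2 * (1 * (x i - n * p i) - n * η)) +
              Real.exp (η / 2 * (-1 * (x i - n * p i) - n * η)) := fun i _ => by positivity
        split_ifs with h
        · exact Finset.sum_nonneg hnn
        · rw [pi_norm_lt_iff h0] at h
          push Not at h
          obtain ⟨i, hi⟩ := h
          refine le_trans ?_ (Finset.single_le_sum hnn (Finset.mem_univ i))
          have hd : (x i : ℝ) - n * p i = n * deviation n p x i := by
            simp only [deviation]; field_simp
          rw [Real.norm_eq_abs] at hi
          rcases le_abs'.1 hi with h | h
          · refine (Real.one_le_exp ?_).trans (le_add_of_nonneg_left (Real.exp_pos _).le)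
            rw [hd]
            have := mul_le_mul_of_nonneg_left h hn'.le
            exact mul_nonneg (by positivity) (by linarith)
          · refine (Real.one_le_exp ?_).trans (le_add_of_nonneg_right (Real.exp_pos _).le)
            rw [hd]
            have := mul_le_mul_of_nonneg_left h hn'.le
            exact mul_nonneg (by positivity) (by linarith)
    _ ≤ ∑ _i : ι, (Real.exp (-(η ^ 2 / 4) * n) + Real.exp (-(η ^ 2 / 4) * n)) := by
        rw [multinomialExp_sum]
        refine Finset.sum_le_sum fun i _ => ?_
        rw [multinomialExp_add]
        exact add_le_add (multinomialExp_tail_apply hp i 1 (by simp) h0.le h1)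
          (multinomialExp_tail_apply hp i (-1) (by simp) h0.le h1)
    _ = _ := by
        rw [Finset.sum_const, Finset.card_univ, nsmul_eq_mul]
        ring

end Multinomial

/-! ### Second order expansion of the squared error -/

section SecondOrder

variable {E : Type*} [NormedAddCommGroup E] [NormedSpace ℝ E] {f : E → ℝ} {p : E}

theorem TimesDifferentiableAt.eventually_differentiableAt (hf : TimesDifferentiableAt 2 f p) :
    ∀ᶠ q in 𝓝 p, DifferentiableAt ℝ f q := by
  filter_upwards [(hf 0 (by norm_num)).2 (by norm_num)] with q hq
  rw [iteratedFDeriv_zero_eq_comp] at hq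
  exact (LinearIsometryEquiv.comp_differentiableAt_iff _).1 hq

theorem TimesDifferentiableAt.differentiableAt_fderiv (hf : TimesDifferentiableAt 2 f p) :
    DifferentiableAt ℝ (fderiv ℝ f) p := by
  have h := (hf 1 (by norm_num)).1
  have h' : fderiv ℝ f = fun y => continuousMultilinearCurryFin1 ℝ E ℝ (iteratedFDeriv ℝ 1 f y) := by
    funext y
    ext w
    simp
  rw [h']
  exact (continuousMultilinearCurryFin1 ℝ E ℝ).toContinuousLinearEquiv.differentiableAt.comp p h

/-- The remainder of the second order Taylor expansion of `f` at `p` has a small Lipschitz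
constant on small balls. -/
theorem exists_abs_taylor_remainder_sub_le (h1 : ∀ᶠ q in 𝓝 p, DifferentiableAt ℝ f q)
    (h2 : DifferentiableAt ℝ (fderiv ℝ f) p) {ε : ℝ} (hε : 0 < ε) :
    ∃ η > 0, ∀ ρ < η, ∀ x y : E, ‖x‖ ≤ ρ → ‖y‖ ≤ ρ →
      |(f (p + x) - fderiv ℝ f p x - fderiv ℝ (fderiv ℝ f) p x x / 2)
        - (f (p + y) - fderiv ℝ f p y - fderiv ℝ (fderiv ℝ f) p y y / 2)| ≤ ε * ρ * ‖x - y‖ := by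
  set H := fderiv ℝ (fderiv ℝ f) p with hH
  have hsymm : ∀ u w, H u w = H w u := fun u w =>
    second_derivative_symmetric_of_eventually (f := f) (f' := fderiv ℝ f) (x := p)
      (h1.mono fun q hq => hq.hasFDerivAt) h2.hasFDerivAt u w
  have h3 := (hasFDerivAt_iff_isLittleO_nhds_zero.1 h2.hasFDerivAt).def hε
  have h4 : ∀ᶠ x : E in 𝓝 0, DifferentiableAt ℝ f (p + x) := by
    have : Tendsto (fun x : E => p + x) (𝓝 0) (𝓝 p) := by
      have h : Continuous fun x : E => p + x := by fun_prop
      simpa using h.tendsto 0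
    exact this.eventually h1
  obtain ⟨η, hη, hball⟩ := Metric.eventually_nhds_iff_ball.1 (h3.and h4)
  refine ⟨η, hη, fun ρ hρ x y hx hy => ?_⟩
  -- By symmetry of `H`, the remainder has derivative `f'(p + z) - f'(p) - H z`, of norm at most `ε
  -- ‖z‖`; the mean value inequality on the convex ball then finishes.
  have hd : ∀ z ∈ Metric.closedBall (0 : E) ρ, HasFDerivWithinAt
      (fun x => f (p + x) - fderiv ℝ f p x - H x x / 2)
      (fderiv ℝ f (p + z) - fderiv ℝ f p - H z) (Metric.closedBall (0 : E) ρ) z := by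
    intro z hz
    have hz' := (hball z (Metric.closedBall_subset_ball hρ hz)).2
    have e1 : HasFDerivAt (fun x => f (p + x)) (fderiv ℝ f (p + z)) z :=
      (hasFDerivAt_comp_add_left p).2 hz'.hasFDerivAt
    have e2 : HasFDerivAt (fun x => H x x) (H z + H.flip z) z := by
      have := (H.hasFDerivAt (x := z)).clm_apply (hasFDerivAt_id z)
      refine this.congr_fderiv ?_
      ext w
      simp
    have e3 := (e1.sub (fderiv ℝ f p).hasFDerivAt).sub (e2.mul_const (1 / 2 : ℝ))
    refine ((e3.congr_fderiv ?_).congr_of_eventuallyEq ?_).hasFDerivWithinAt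
    · ext w
      simp [hsymm w z]
      ring
    · exact Eventually.of_forall fun w => by simp; ring
  have := (convex_closedBall (0 : E) ρ).norm_image_sub_le_of_norm_hasFDerivWithin_le
    (C := ε * ρ) hd (fun z hz => ?_) (x := y) (y := x) (by simpa using hy) (by simpa using hx)
  · simpa using this
  · have := (hball z (Metric.closedBall_subset_ball hρ hz)).1
    refine this.trans (mul_le_mul_of_nonneg_left (by simpa using hz) hε.le)

/-- The leading part of the difference of the squared errors at `p + (1 + c a)⁻¹ (z - α a v)` and
at `p + z`, in terms of the derivative `L` and the second derivative `H` at `p`. -/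
noncomputable def leadingPart (L : E →L[ℝ] ℝ) (H : E →L[ℝ] E →L[ℝ] ℝ) (v : E) (α c : ℝ) (z : E) (a : ℝ) : ℝ :=
  -2 * (c * a) * (L z * L z) - 2 * (α * a) * L v * L z + (α * a) ^ 2 * L v ^ 2
    - α * a * L v * H z z - 2 * (α * a) * (H z v * L z)

theorem isBigO_clm_apply₂ {W : Type*} {l : Filter W} (H : E →L[ℝ] E →L[ℝ] ℝ) {x y : W → E}
    {g h : W → ℝ} (hx : x =O[l] g) (hy : y =O[l] h) :
    (fun w => H (x w) (y w)) =O[l] fun w => g w * h w := by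
  refine (IsBigO.of_bound ‖H‖ (Eventually.of_forall fun w => ?_)).trans
    (hx.norm_left.mul hy.norm_left)
  rw [Real.norm_of_nonneg (r := ‖x w‖ * ‖y w‖) (by positivity), ← mul_assoc]
  exact H.le_opNorm₂ _ _

/-- The difference of squares factors as `Y (2F + Y)`, where `F` is the error at `p + z` and `Y` the
change caused by the shift `d = O(a)`. Thus every term carries a factor `a`, and it remains to
expand both factors to second order. -/
theorem isLittleO_sq_error_sub (h1 : ∀ᶠ q in 𝓝 p, DifferentiableAt ℝ f q)
    (h2 : DifferentiableAt ℝ (fderiv ℝ f) p) (v : E) (α c : ℝ) :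
    (fun w : E × ℝ => (f (p + (1 + c * w.2)⁻¹ • (w.1 - (α * w.2) • v)) - f p) ^ 2
        - (f (p + w.1) - f p) ^ 2
        - leadingPart (fderiv ℝ f p) (fderiv ℝ (fderiv ℝ f) p) v α c w.1 w.2)
      =o[𝓝 0] fun w => w.2 * (‖w.1‖ ^ 2 + |w.2|) := by
  set L := fderiv ℝ f p with hL
  set H := fderiv ℝ (fderiv ℝ f) p with hH
  have hsymm : ∀ u w, H u w = H w u := fun u w =>
    second_derivative_symmetric_of_eventually (f := f) (f' := fderiv ℝ f) (x := p)
      (h1.mono fun q hq => hq.hasFDerivAt) h2.hasFDerivAt u w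
  set T : E × ℝ → ℝ := fun w => w.2 * (‖w.1‖ ^ 2 + |w.2|) with hT
  set m : E × ℝ → ℝ := fun w => ‖w.1‖ + |w.2| with hm
  set a : E × ℝ → ℝ := fun w => w.2 with ha
  set z : E × ℝ → E := fun w => w.1 with hz
  set δ : E × ℝ → E := fun w => (1 + c * w.2)⁻¹ • (w.1 - (α * w.2) • v) with hδ
  set d : E × ℝ → E := fun w => δ w - z w with hd
  have hmc : Tendsto m (𝓝 0) (𝓝 0) := by
    have : Continuous m := by fun_prop
    simpa [hm] using this.tendsto 0
  have hm1 : m =o[𝓝 0] fun _ => (1 : ℝ) := (isLittleO_one_iff ℝ).2 hmc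
  have hmO : m =O[𝓝 0] fun _ => (1 : ℝ) := hm1.isBigO
  have ham : a =O[𝓝 0] m := IsBigO.of_bound 1 (Eventually.of_forall fun w => by
    simp only [ha, hm, Real.norm_eq_abs, one_mul]
    rw [abs_of_nonneg (a := ‖w.1‖ + |w.2|) (by positivity)]
    linarith [norm_nonneg w.1])
  have hzm : z =O[𝓝 0] m := IsBigO.of_bound 1 (Eventually.of_forall fun w => by
    simp only [hz, hm, Real.norm_eq_abs, one_mul]
    rw [abs_of_nonneg (a := ‖w.1‖ + |w.2|) (by positivity)]
    linarith [abs_nonneg w.2])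
  have haa : (fun w => a w * a w) =O[𝓝 0] T := IsBigO.of_bound 1 (Eventually.of_forall fun w => by
    simp only [ha, hT, Real.norm_eq_abs, one_mul, abs_mul]
    rw [abs_of_nonneg (a := ‖w.1‖ ^ 2 + |w.2|) (by positivity)]
    exact mul_le_mul_of_nonneg_left (by linarith [sq_nonneg ‖w.1‖]) (abs_nonneg _))
  -- `m² ≤ 2 (‖z‖² + a²)`, and `a² ≤ |a|` once `m < 1`.
  have hamm : (fun w => a w * (m w * m w)) =O[𝓝 0] T := by
    have hev : ∀ᶠ w in 𝓝 (0 : E × ℝ), m w < 1 := hmc.eventually_lt_const one_pos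
    refine IsBigO.of_bound 2 (hev.mono fun w hw => ?_)
    simp only [ha, hT, hm, Real.norm_eq_abs, abs_mul] at hw ⊢
    rw [abs_of_nonneg (a := ‖w.1‖ ^ 2 + |w.2|) (by positivity),
      abs_of_nonneg (a := ‖w.1‖ + |w.2|) (by positivity), mul_left_comm 2]
    refine mul_le_mul_of_nonneg_left ?_ (abs_nonneg w.2)
    nlinarith [norm_nonneg w.1, abs_nonneg w.2]
  have S1 : (fun w => a w * (m w * m w) * m w) =o[𝓝 0] T := by
    simpa using hamm.mul_isLittleO hm1
  have S2 : (fun w => a w * a w * m w) =o[𝓝 0] T := by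
    simpa using haa.mul_isLittleO hm1
  have hne : ∀ᶠ w : E × ℝ in 𝓝 0, 1 + c * w.2 ≠ 0 := by
    have : ContinuousAt (fun w : E × ℝ => 1 + c * w.2) 0 := by fun_prop
    exact this.eventually_ne (by simp)
  have hδm : δ =O[𝓝 0] m := by
    have e1 : (fun w : E × ℝ => (1 + c * w.2)⁻¹) =O[𝓝 0] fun _ => (1 : ℝ) := by
      have : ContinuousAt (fun w : E × ℝ => (1 + c * w.2)⁻¹) 0 :=
        ContinuousAt.inv₀ (by fun_prop) (by simp)
      exact this.isBigO_one ℝ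
    have e2 : (fun w : E × ℝ => (α * w.2) • v) =O[𝓝 0] m := by
      simpa using (ham.const_mul_left α).smul
        (isBigO_const_const v (one_ne_zero (α := ℝ)) (𝓝 (0 : E × ℝ)))
    simpa using e1.smul (hzm.sub e2)
  -- This implicit relation for `d` avoids expanding the inverse `(1 + c a)⁻¹`.
  have hdδ : ∀ᶠ w in 𝓝 0, d w = -(c * a w) • δ w - (α * a w) • v := by
    filter_upwards [hne] with w hw
    have : (1 + c * w.2) • δ w = w.1 - (α * w.2) • v := by
      simp only [hδ]; rw [smul_inv_smul₀ hw]
    rw [add_smul, one_smul] at this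
    simp only [hd, ha, hz]
    rw [neg_smul, ← sub_eq_zero]
    rw [← sub_eq_zero] at this
    rw [← this]
    abel
  have hda : d =O[𝓝 0] a := by
    have e1 : (fun w => (-(c * a w)) • δ w) =O[𝓝 0] a := by
      simpa [-neg_smul] using ((isBigO_refl a (𝓝 0)).const_mul_left c).neg_left.smul (hδm.trans hmO)
    have e2 : (fun w => (α * a w) • v) =O[𝓝 0] a := by
      simpa using ((isBigO_refl a (𝓝 0)).const_mul_left α).smul
        (isBigO_const_const v (one_ne_zero (α := ℝ)) (𝓝 (0 : E × ℝ)))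
    exact (e1.sub e2).congr' (hdδ.mono fun w hw => hw.symm) EventuallyEq.rfl
  have hdm : d =O[𝓝 0] m := hda.trans ham
  have Lz := (L.isBigO_comp z (𝓝 0)).trans hzm
  have Lδ := (L.isBigO_comp δ (𝓝 0)).trans hδm
  have Ld := (L.isBigO_comp d (𝓝 0)).trans hda
  have Hzz := isBigO_clm_apply₂ H hzm hzm
  have Hδz := isBigO_clm_apply₂ H hδm hzm
  have Hzd := isBigO_clm_apply₂ H hzm hda
  have Hdd := isBigO_clm_apply₂ H hda hda
  set F : E × ℝ → ℝ := fun w => f (p + z w) - f p with hF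
  set Y : E × ℝ → ℝ := fun w => f (p + δ w) - f (p + z w) with hY
  set r₂ : E × ℝ → ℝ := fun w => F w - L (z w) - H (z w) (z w) / 2 with hr₂
  set r₁ : E × ℝ → ℝ := fun w => Y w - L (d w) - H (z w) (d w) - H (d w) (d w) / 2 with hr₁
  have small₂ : r₂ =o[𝓝 0] fun w => m w * m w := by
    refine IsLittleO.of_bound fun ε hε => ?_
    obtain ⟨η, hη, hb⟩ := exists_abs_taylor_remainder_sub_le h1 h2 hε
    filter_upwards [hmc.eventually_lt_const hη] with w hw
    have hzw : ‖z w‖ ≤ m w := by simp only [hz, hm]; linarith [abs_nonneg w.2]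
    have hmw : 0 ≤ m w := (norm_nonneg _).trans hzw
    have := hb (m w) hw (z w) 0 hzw (by simpa using hmw)
    simp only [map_zero, add_zero, sub_zero, zero_div] at this
    rw [Real.norm_eq_abs, Real.norm_of_nonneg (by positivity), ← mul_assoc]
    calc |r₂ w| ≤ ε * m w * ‖z w‖ := by
          refine le_of_eq_of_le ?_ this
          simp only [hr₂, hF]
          congr 1
          ring
      _ ≤ _ := by gcongr
  -- Bounding the Taylor remainders at `δ` and `z` separately would only give `o(m²)`. The Lipschitz
  -- estimate for their difference supplies the factor `‖d‖ = O(a)`; the ball of radius `(C + 1) m`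
  -- contains both points.
  have small₁ : r₁ =o[𝓝 0] fun w => a w * m w := by
    obtain ⟨C, hC, hCb⟩ := hδm.exists_pos
    have hd' : r₁ =o[𝓝 0] fun w => ‖d w‖ * m w := by
      refine IsLittleO.of_bound fun ε hε => ?_
      obtain ⟨η, hη, hb⟩ := exists_abs_taylor_remainder_sub_le h1 h2
        (ε := ε / (C + 1)) (by positivity)
      have hmη : Tendsto (fun w => (C + 1) * m w) (𝓝 0) (𝓝 0) := by simpa using hmc.const_mul (C + 1)
      filter_upwards [hmη.eventually_lt_const hη, hCb.bound] with w hw hδw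
      have hzw : ‖z w‖ ≤ m w := by simp only [hz, hm]; linarith [abs_nonneg w.2]
      have hmw : 0 ≤ m w := (norm_nonneg _).trans hzw
      rw [Real.norm_of_nonneg hmw] at hδw
      have := hb _ hw (δ w) (z w) (by linarith) (by nlinarith)
      rw [Real.norm_eq_abs, Real.norm_of_nonneg (by positivity)]
      calc |r₁ w| ≤ ε / (C + 1) * ((C + 1) * m w) * ‖δ w - z w‖ := by
            refine le_of_eq_of_le ?_ this
            simp only [hr₁, hY, hd, map_sub, sub_apply, hsymm (δ w) (z w)]
            congr 1
            ring
        _ = ε * (‖d w‖ * m w) := by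
            simp only [hd]
            field_simp
    exact hd'.trans_isBigO (hda.norm_left.mul (isBigO_refl m _))
  have Q₁ : (fun w => H (d w) (d w) / 2) =O[𝓝 0] fun w => a w * a w := by
    simpa only [div_eq_inv_mul] using Hdd.const_mul_left (2⁻¹ : ℝ)
  have haam : (fun w => a w * a w) =O[𝓝 0] fun w => a w * m w := (isBigO_refl a _).mul ham
  have hmm : (fun w => m w * m w) =O[𝓝 0] m := by
    simpa using (isBigO_refl m (𝓝 0)).mul hmO
  have hama : (fun w => a w * m w) =O[𝓝 0] a := by
    simpa using (isBigO_refl a (𝓝 0)).mul hmO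
  have Hzd' : (fun w => H (z w) (d w)) =O[𝓝 0] fun w => a w * m w := by
    simpa only [mul_comm] using Hzd
  have Q : (fun w => H (d w) (d w) / 2 + r₁ w) =O[𝓝 0] fun w => a w * m w :=
    (Q₁.trans haam).add small₁.isBigO
  have hYO : Y =O[𝓝 0] a := by
    refine ((Ld.add (Hzd'.trans hama)).add (Q.trans hama)).congr_left fun w => ?_
    simp only [hr₁]
    ring
  have hR : (fun w => H (z w) (z w) + 2 * r₂ w) =O[𝓝 0] fun w => m w * m w :=
    Hzz.add (small₂.isBigO.const_mul_left 2)
  have hFY : (fun w => 2 * F w + Y w) =O[𝓝 0] m := by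
    refine (((Lz.const_mul_left 2).add (hR.trans hmm)).add (hYO.trans ham)).congr_left fun w => ?_
    simp only [hr₂]
    ring
  -- The ten error terms are each `O(a² m)`, `O(a m³)` or `o(a m²)`; their sum is exactly the
  -- left-hand side, as checked at the end.
  have t₁ : (fun w => -2 * c * (a w * L (d w) * L (z w))) =o[𝓝 0] T :=
    ((((isBigO_refl a _).mul Ld).mul Lz).trans_isLittleO S2).const_mul_left _
  have t₂ : (fun w => -c * (a w * (L (δ w) * H (z w) (z w)))) =o[𝓝 0] T :=
    ((((isBigO_refl a _).mul (Lδ.mul Hzz))).trans_isLittleO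
      (S1.congr_left fun w => by ring)).const_mul_left _
  have t₃ : (fun w => 2 * (L (d w) * r₂ w)) =o[𝓝 0] T :=
    ((Ld.mul_isLittleO small₂).trans_isBigO hamm).const_mul_left _
  have t₄ : (fun w => -c * (a w * (L (d w) - α * a w * L v) * L (δ w))) =o[𝓝 0] T := by
    have : (fun w => L (d w) - α * a w * L v) =O[𝓝 0] a :=
      Ld.sub (((isBigO_refl a _).const_mul_left (α * L v)).congr_left fun w => by ring)
    exact ((((isBigO_refl a _).mul this).mul Lδ).trans_isLittleO S2).const_mul_left _
  have t₅ : (fun w => L (d w) * (H (z w) (d w) + (H (d w) (d w) / 2 + r₁ w))) =o[𝓝 0] T :=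
    (Ld.mul (Hzd'.add Q)).trans_isLittleO (S2.congr_left fun w => by ring)
  have t₆ : (fun w => -2 * c * (a w * (H (δ w) (z w) * L (z w)))) =o[𝓝 0] T :=
    (((isBigO_refl a _).mul (Hδz.mul Lz)).trans_isLittleO
      (S1.congr_left fun w => by ring)).const_mul_left _
  have t₇ : (fun w => H (z w) (d w) * (H (z w) (z w) + 2 * r₂ w)) =o[𝓝 0] T :=
    (Hzd'.mul hR).trans_isLittleO (S1.congr_left fun w => by ring)
  have t₈ : (fun w => H (z w) (d w) * Y w) =o[𝓝 0] T :=
    (Hzd'.mul hYO).trans_isLittleO (S2.congr_left fun w => by ring)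
  have t₉ : (fun w => H (d w) (d w) / 2 * (2 * F w + Y w)) =o[𝓝 0] T :=
    (Q₁.mul hFY).trans_isLittleO S2
  have t₁₀ : (fun w => r₁ w * (2 * F w + Y w)) =o[𝓝 0] T :=
    ((small₁.mul_isBigO hFY).congr_right fun w => by ring).trans_isBigO hamm
  refine ((((((((((t₁.add t₂).add t₃).add t₄).add t₅).add t₆).add t₇).add t₈).add t₉).add
    t₁₀)).congr' ?_ EventuallyEq.rfl
  filter_upwards [hdδ] with w hw
  have k₁ : L (d w) = -(c * a w) * L (δ w) - α * a w * L v := by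
    conv_lhs => rw [hw]
    simp
  have k₂ : H (z w) (d w) = -(c * a w) * H (δ w) (z w) - α * a w * H (z w) v := by
    conv_lhs => rw [hw]
    simp [hsymm (δ w)]
  have k₃ : L (δ w) = L (z w) + L (d w) := by simp [hd]
  have hFw : F w = L (z w) + H (z w) (z w) / 2 + r₂ w := by simp only [hr₂]; ring
  have hYw : Y w = L (d w) + H (z w) (d w) + H (d w) (d w) / 2 + r₁ w := by
    simp only [hr₁]; ring
  have hlhs : (f (p + (1 + c * w.2)⁻¹ • (w.1 - (α * w.2) • v)) - f p) ^ 2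
        - (f (p + w.1) - f p) ^ 2 = Y w * (2 * F w + Y w) := by
    simp only [hF, hY, hz, hδ]; ring
  rw [hlhs, hYw, hFw]
  simp only [leadingPart]
  change _ = _ - (-2 * (c * a w) * (L (z w) * L (z w)) - 2 * (α * a w) * L v * L (z w)
    + (α * a w) ^ 2 * L v ^ 2 - α * a w * L v * H (z w) (z w)
    - 2 * (α * a w) * (H (z w) v * L (z w)))
  linear_combination -(2 * L (z w) + H (z w) (z w) + L (d w) - α * a w * L v) * k₁
    + 2 * L (z w) * c * a w * k₃ - 2 * L (z w) * k₂

end SecondOrder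

/-! ### Expectation of the leading part and of the error scale -/

section Moments

variable {ι : Type*} [Fintype ι] [DecidableEq ι] {n : ℕ} {p : ι → ℝ}

theorem multinomialExp_quadratic (hp : ∑ t, p t = 1) (hn : n ≠ 0) (M : Matrix ι ι ℝ) :
    multinomialExp n p
        (fun x => ∑ i, ∑ j, M i j * (deviation n p x i * deviation n p x j)) =
      (n : ℝ)⁻¹ * (M * cov p).trace := by
  rw [multinomialExp_sum]
  simp only [Matrix.trace, Matrix.diag, Matrix.mul_apply, Finset.mul_sum]
  refine Finset.sum_congr rfl fun i _ => ?_
  rw [multinomialExp_sum]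
  refine Finset.sum_congr rfl fun j _ => ?_
  rw [multinomialExp_const_mul]
  simp only [mul_comm (deviation n p _ i)]
  rw [multinomialExp_deviation_mul hp hn j i]
  ring

/-- The sup norm is at most the Euclidean norm, whose square has mean `tr Σ / n`. This makes the
pointwise error `o(n⁻²)` in mean. -/
theorem multinomialExp_norm_sq_le (hp : p ∈ stdSimplex ℝ ι) (hn : n ≠ 0) :
    multinomialExp n p (fun x => ‖deviation n p x‖ ^ 2) ≤ (n : ℝ)⁻¹ * (cov p).trace := by
  have h := multinomialExp_quadratic hp.2 hn (1 : Matrix ι ι ℝ)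
  rw [one_mul] at h
  rw [← h]
  refine multinomialExp_mono hp.1 fun x _ => ?_
  simp only [Matrix.one_apply, ite_mul, one_mul, zero_mul, Finset.sum_ite_eq, Finset.mem_univ,
    if_true]
  have h0 : 0 ≤ ∑ i, deviation n p x i * deviation n p x i :=
    Finset.sum_nonneg fun i _ => mul_self_nonneg _
  rw [← Real.sqrt_le_sqrt_iff h0, Real.sqrt_sq (norm_nonneg _)]
  refine (pi_norm_le_iff_of_nonneg (Real.sqrt_nonneg _)).2 fun i => ?_
  rw [Real.norm_eq_abs, ← Real.sqrt_mul_self_eq_abs]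
  exact Real.sqrt_le_sqrt (Finset.single_le_sum (f := fun i => deviation n p x i * deviation n p x i)
    (fun i _ => mul_self_nonneg _) (Finset.mem_univ i))

omit [DecidableEq ι] in
theorem norm_deviation_le_one (hp : p ∈ stdSimplex ℝ ι) {x : ι → ℕ} (hx : ∑ t, x t = n) :
    ‖deviation n p x‖ ≤ 1 := by
  refine (pi_norm_le_iff_of_nonneg zero_le_one).2 fun i => ?_
  have h1 : p i ≤ 1 := hp.2 ▸ Finset.single_le_sum (fun t _ => hp.1 t) (Finset.mem_univ i)
  have h2 : (x i : ℝ) ≤ n := by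
    exact_mod_cast hx ▸ Finset.single_le_sum (fun t _ => Nat.zero_le (x t)) (Finset.mem_univ i)
  have h3 : (x i : ℝ) / n ≤ 1 := div_le_one_of_le₀ h2 (Nat.cast_nonneg _)
  have h4 : (0 : ℝ) ≤ (x i : ℝ) / n := by positivity
  rw [Real.norm_eq_abs, abs_le, deviation]
  constructor <;> linarith [hp.1 i]

theorem fderiv_apply_eq_sum (f : (ι → ℝ) → ℝ) (u : ι → ℝ) :
    fderiv ℝ f p u = ∑ i, grad f p i * u i := by
  conv_lhs => rw [pi_eq_sum_univ' u]
  simp [grad, mul_comm]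

theorem fderiv_fderiv_apply_eq_sum {f : (ι → ℝ) → ℝ} (h2 : DifferentiableAt ℝ (fderiv ℝ f) p)
    (u w : ι → ℝ) :
    fderiv ℝ (fderiv ℝ f) p u w = ∑ i, ∑ j, hess f p i j * (u i * w j) := by
  have hh : ∀ i j, hess f p i j = fderiv ℝ (fderiv ℝ f) p (Pi.single i 1) (Pi.single j 1) := by
    intro i j
    rw [hess, Matrix.of_apply, fderiv_clm_apply h2 (by fun_prop)]
    simp
  conv_lhs => rw [pi_eq_sum_univ' u, pi_eq_sum_univ' w]
  simp only [map_sum, map_smul, _root_.sum_apply, _root_.smul_apply,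
    smul_eq_mul, hh, Finset.mul_sum]
  rw [Finset.sum_comm]
  exact Finset.sum_congr rfl fun i _ => Finset.sum_congr rfl fun j _ => by ring

/-- The term linear in the deviation averages to zero, and each quadratic term becomes a trace
against `cov p`. -/
theorem multinomialExp_leadingPart (hp : p ∈ stdSimplex ℝ ι) (hn : n ≠ 0) {f : (ι → ℝ) → ℝ}
    (h1 : ∀ᶠ q in 𝓝 p, DifferentiableAt ℝ f q) (h2 : DifferentiableAt ℝ (fderiv ℝ f) p)
    (v : ι → ℝ) (α c a : ℝ) :
    multinomialExp n p (fun x => leadingPart (fderiv ℝ f p) (fderiv ℝ (fderiv ℝ f) p) v α c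
        (deviation n p x) a) =
      -2 * (c * a) * ((n : ℝ)⁻¹ * (Matrix.vecMulVec (grad f p) (grad f p) * cov p).trace)
        + (α * a) ^ 2 * (v ⬝ᵥ grad f p) ^ 2
        - α * a * (v ⬝ᵥ grad f p) * ((n : ℝ)⁻¹ * (hess f p * cov p).trace)
        - 2 * (α * a) *
          ((n : ℝ)⁻¹ * (Matrix.vecMulVec (grad f p) v * hess f p * cov p).trace) := by
  have hsymm : ∀ u w, fderiv ℝ (fderiv ℝ f) p u w = fderiv ℝ (fderiv ℝ f) p w u := fun u w =>
    second_derivative_symmetric_of_eventually (f := f) (f' := fderiv ℝ f) (x := p)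
      (h1.mono fun q hq => hq.hasFDerivAt) h2.hasFDerivAt u w
  have hLv : fderiv ℝ f p v = v ⬝ᵥ grad f p := by
    rw [fderiv_apply_eq_sum, dotProduct]
    exact Finset.sum_congr rfl fun i _ => mul_comm _ _
  have e1 : multinomialExp n p (fun x => fderiv ℝ f p (deviation n p x)) = 0 := by
    simp only [fderiv_apply_eq_sum, multinomialExp_sum, multinomialExp_const_mul,
      multinomialExp_deviation hp.2 hn, mul_zero, Finset.sum_const_zero]
  have e2 : multinomialExp n p (fun x => fderiv ℝ f p (deviation n p x) *
      fderiv ℝ f p (deviation n p x)) =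
      (n : ℝ)⁻¹ * (Matrix.vecMulVec (grad f p) (grad f p) * cov p).trace := by
    rw [← multinomialExp_quadratic hp.2 hn]
    congr 1
    funext x
    simp only [fderiv_apply_eq_sum, Finset.sum_mul_sum, Matrix.vecMulVec_apply]
    exact Finset.sum_congr rfl fun i _ => Finset.sum_congr rfl fun j _ => by ring
  have e3 : multinomialExp n p (fun x => fderiv ℝ (fderiv ℝ f) p (deviation n p x)
      (deviation n p x)) = (n : ℝ)⁻¹ * (hess f p * cov p).trace := by
    simp only [fderiv_fderiv_apply_eq_sum h2]
    exact multinomialExp_quadratic hp.2 hn _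
  have e4 : multinomialExp n p (fun x => fderiv ℝ (fderiv ℝ f) p (deviation n p x) v *
      fderiv ℝ f p (deviation n p x)) =
      (n : ℝ)⁻¹ * (Matrix.vecMulVec (grad f p) v * hess f p * cov p).trace := by
    rw [← multinomialExp_quadratic hp.2 hn]
    congr 1
    funext x
    rw [hsymm, fderiv_fderiv_apply_eq_sum h2, fderiv_apply_eq_sum, mul_comm]
    rw [Finset.sum_comm, Finset.sum_mul_sum]
    refine Finset.sum_congr rfl fun i _ => Finset.sum_congr rfl fun j _ => ?_
    simp only [Matrix.mul_apply, Matrix.vecMulVec_apply, Finset.mul_sum, Finset.sum_mul]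
    exact Finset.sum_congr rfl fun l _ => by ring
  simp only [leadingPart, multinomialExp_add, multinomialExp_sub, multinomialExp_const_mul,
    multinomialExp_const hp.2, e1, e2, e3, e4, hLv]
  ring

end Moments

/-! ### Specialization to the posterior mean -/

section Table

variable {r c : ℕ} {p : Fin r × Fin c → ℝ}

theorem posteriorMean_eq {n : ℕ} (hn : n ≠ 0) {α : ℝ} (hα : 0 ≤ α) {x : Fin r × Fin c → ℕ}
    (hx : ∑ t, x t = n) :
    posteriorMean α x = p + (1 + (r : ℝ) * c * α * (n : ℝ)⁻¹)⁻¹ •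
      (deviation n p x - (α * (n : ℝ)⁻¹) • shift p) := by
  funext t
  have hn' : (0 : ℝ) < n := by positivity
  have h1 : (0 : ℝ) < n + r * c * α := by positivity
  have h2 : 1 + (r : ℝ) * c * α * (n : ℝ)⁻¹ = (n + r * c * α) / n := by field_simp
  rw [h2]
  simp only [posteriorMean, hx, Pi.add_apply, Pi.smul_apply, Pi.sub_apply, smul_eq_mul, deviation,
    shift]
  field_simp
  ring

theorem multinomialExp_leadingPart_shift (hp : p ∈ stdSimplex ℝ (Fin r × Fin c)) {n : ℕ}
    (hn : n ≠ 0) {f : (Fin r × Fin c → ℝ) → ℝ}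
    (h1 : ∀ᶠ q in 𝓝 p, DifferentiableAt ℝ f q) (h2 : DifferentiableAt ℝ (fderiv ℝ f) p)
    (α : ℝ) :
    multinomialExp n p (fun x => leadingPart (fderiv ℝ f p) (fderiv ℝ (fderiv ℝ f) p) (shift p) α
        ((r : ℝ) * c * α) (deviation n p x) (n : ℝ)⁻¹) =
      1 / (n : ℝ) ^ 2 * (A₁ f p * α ^ 2 - 2 * A₂ f p * α) := by
  have hA₁ : A₁ f p = (shift p ⬝ᵥ grad f p) ^ 2 := by
    rw [A₁, Matrix.vecMulVec_mul_vecMulVec, Matrix.trace_vecMulVec, dotProduct_smul, smul_eq_mul,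
      dotProduct_comm (grad f p), sq]
  rw [multinomialExp_leadingPart hp hn h1 h2, hA₁, A₂]
  ring

end Table

/-! ### Auxiliary facts for the final estimate -/

theorem TimesDifferentiableAt.of_le {E : Type*} [NormedAddCommGroup E] [NormedSpace ℝ E]
    {f : E → ℝ} {p : E} {k l : ℕ} (hf : TimesDifferentiableAt l f p) (h : k ≤ l) :
    TimesDifferentiableAt k f p :=
  fun m hm => ⟨(hf m (hm.trans_le h)).1, fun hm' => (hf m (hm.trans_le h)).2 (hm'.trans_le h)⟩

theorem mse_eq_multinomialExp {Ω : Type*} [MeasurableSpace Ω] {P : Measure Ω} {r c n : ℕ}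
    {p : Fin r × Fin c → ℝ} (hp : ∀ t, 0 ≤ p t) {N : Ω → Fin r × Fin c → ℕ}
    (hN : HasLaw N (multinomialMeasure n p) P) (f : (Fin r × Fin c → ℝ) → ℝ) (α : ℝ) :
    mse P N f p α = multinomialExp n p fun x => (f (posteriorMean α x) - f p) ^ 2 := by
  rw [← integral_multinomialMeasure hp]
  exact hN.integral_comp (f := fun x => (f (posteriorMean α x) - f p) ^ 2)
    (measurable_of_countable _).aestronglyMeasurable

theorem eventually_exp_le_inv_sq {b K C : ℝ} (hb : 0 < b) (hK : 0 < K) (hC : 0 < C) :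
    ∀ᶠ n : ℕ in atTop, K * Real.exp (-b * n) ≤ C * (1 / (n : ℝ) ^ 2) := by
  have h := ((isLittleO_pow_exp_pos_mul_atTop 2 hb).comp_tendsto
    (tendsto_natCast_atTop_atTop (R := ℝ))).def (div_pos hC hK)
  filter_upwards [h, eventually_gt_atTop 0] with n hn hn0
  have hn' : (0 : ℝ) < n := by exact_mod_cast hn0
  simp only [Function.comp_apply, norm_pow, Real.norm_eq_abs, Real.abs_exp, sq_abs] at hn
  rw [neg_mul, Real.exp_neg, mul_one_div, ← div_eq_mul_inv, div_le_div_iff₀ (Real.exp_pos _)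
    (by positivity)]
  rw [div_mul_eq_mul_div, le_div_iff₀ hK] at hn
  linarith

/-- Continuity on a compact ball. Away from `p` the expansion is useless, and boundedness of the
leading part is enough against the exponentially small tail. -/
theorem exists_abs_leadingPart_le {E : Type*} [NormedAddCommGroup E] [NormedSpace ℝ E]
    [ProperSpace E] (L : E →L[ℝ] ℝ) (H : E →L[ℝ] E →L[ℝ] ℝ) (v : E) (α c : ℝ) :
    ∃ K, ∀ z a, ‖z‖ ≤ 1 → |a| ≤ 1 → |leadingPart L H v α c z a| ≤ K := by
  have hc : Continuous fun w : E × ℝ => leadingPart L H v α c w.1 w.2 := by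
    unfold leadingPart
    fun_prop
  obtain ⟨K, hK⟩ := (isCompact_closedBall (0 : E × ℝ) 1).exists_bound_of_continuousOn
    hc.continuousOn
  refine ⟨K, fun z a hz ha => hK (z, a) ?_⟩
  simpa [Prod.norm_def] using ⟨hz, ha⟩

end ContingencyTable

/-! ### The expansion of the mean squared error -/

open ContingencyTable

theorem theorem1 {r c : ℕ} (p : Fin r × Fin c → ℝ) (hp : p ∈ stdSimplex ℝ (Fin r × Fin c))
    (f : (Fin r × Fin c → ℝ) → ℝ) (hf : ContingencyTable.TimesDifferentiableAt 4 f p)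
    {Ω : ℕ → Type*} [∀ n, MeasurableSpace (Ω n)] (P : ∀ n, Measure (Ω n))
    (N : ∀ n, Ω n → Fin r × Fin c → ℕ)
    (hN : ∀ n, HasLaw (N n) (ContingencyTable.multinomialMeasure n p) (P n)) :
    ∃ B : ℕ → ℝ, ∀ α : ℝ, 0 ≤ α → ContingencyTable.SubexponentialAt f α →
      (fun n : ℕ => ContingencyTable.mse (P n) (N n) f p α
          - (1 / (n : ℝ) ^ 2
              * (ContingencyTable.A₁ f p * α ^ 2 - 2 * ContingencyTable.A₂ f p * α) + B n))
        =o[atTop] fun n : ℕ => 1 / (n : ℝ) ^ 2 := by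
  have hf2 : TimesDifferentiableAt 2 f p := hf.of_le (by norm_num)
  have h1 := hf2.eventually_differentiableAt
  have h2 := hf2.differentiableAt_fderiv
  -- The truncation radius of `B` is fixed before `α`, so `B` cannot depend on it.
  obtain ⟨η₀, hη₀, hb₀⟩ : ∃ η₀ > 0, ∀ z, ‖z‖ < η₀ → |f (p + z) - f p| ≤ 1 := by
    have hc : ContinuousAt f p := h1.self_of_nhds.continuousAt
    obtain ⟨η₀, hη₀, h⟩ := Metric.continuousAt_iff.1 hc 1 one_pos
    refine ⟨η₀, hη₀, fun z hz => ?_⟩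
    have := h (x := p + z) (by simpa [dist_eq_norm] using hz)
    rw [Real.dist_eq] at this
    exact this.le
  refine ⟨fun n => multinomialExp n p fun x =>
    if ‖deviation n p x‖ < η₀ then (f (p + deviation n p x) - f p) ^ 2 else 0,
    fun α hα hsub => ?_⟩
  refine IsLittleO.of_bound fun C hC => ?_
  set M : (Fin r × Fin c → ℝ) → ℝ → ℝ :=
    leadingPart (fderiv ℝ f p) (fderiv ℝ (fderiv ℝ f) p) (shift p) α (r * c * α) with hM
  obtain ⟨K₂, hK₂⟩ := exists_abs_leadingPart_le (fderiv ℝ f p) (fderiv ℝ (fderiv ℝ f) p) (shift p)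
    α (r * c * α)
  set K := |(cov p).trace| with hK
  -- The error near `p` has mean at most `ε (K + 1) n⁻²`, which is half of the allowed `C n⁻²`.
  set ε := C / (2 * (K + 1)) with hε
  have hεpos : 0 < ε := by positivity
  obtain ⟨η₁, hη₁, hb₁⟩ := Metric.eventually_nhds_iff_ball.1
    ((isLittleO_sq_error_sub h1 h2 (shift p) α (r * c * α)).def hεpos)
  set η := min (min η₀ η₁) 1 with hη
  have hηpos : 0 < η := by positivity
  have hηη₀ : η ≤ η₀ := (min_le_left _ _).trans (min_le_left _ _)
  have hηη₁ : η ≤ η₁ := (min_le_left _ _).trans (min_le_right _ _)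
  have hη1 : η ≤ 1 := min_le_right _ _
  set K₃ := (1 + |f p|) ^ 2 + 1 + |K₂| with hK₃
  -- The rate `η² / 8` is the Chernoff rate `η² / 4` minus twice the growth rate `η² / 16` granted
  -- to `f`, which enters squared. The `+ 1` keeps the constant visibly positive.
  have htail := eventually_exp_le_inv_sq (b := η ^ 2 / 8)
    (K := K₃ * (2 * Fintype.card (Fin r × Fin c)) + 1) (C := C / 2) (by positivity) (by positivity)
    (by positivity)
  have hinv : ∀ᶠ n : ℕ in atTop, (n : ℝ)⁻¹ < η :=
    tendsto_inv_atTop_nhds_zero_nat.eventually_lt_const hηpos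
  filter_upwards [htail, hinv, hsub (η ^ 2 / 16) (by positivity), eventually_ne_atTop 0] with
    n hnt hni hns hn
  have hn' : (0 : ℝ) < n := by positivity
  set G := Real.exp (η ^ 2 / 16 * n) with hG
  have hG1 : 1 ≤ G := Real.one_le_exp (by positivity)
  rw [mse_eq_multinomialExp hp.1 (hN n), ← multinomialExp_leadingPart_shift hp hn h1 h2,
    ← multinomialExp_add, ← multinomialExp_sub, Real.norm_eq_abs, Real.norm_of_nonneg (by positivity)]
  refine (abs_multinomialExp_le hp.1 _).trans ?_
  have hpt : ∀ x : Fin r × Fin c → ℕ, ∑ t, x t = n →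
      |(f (posteriorMean α x) - f p) ^ 2 - (M (deviation n p x) (n : ℝ)⁻¹ +
        if ‖deviation n p x‖ < η₀ then (f (p + deviation n p x) - f p) ^ 2 else 0)| ≤
      ε * (n : ℝ)⁻¹ * ‖deviation n p x‖ ^ 2 + ε * (n : ℝ)⁻¹ * (n : ℝ)⁻¹ +
        K₃ * G ^ 2 * (if ‖deviation n p x‖ < η then 0 else 1) := by
    intro x hx
    set z := deviation n p x with hz
    -- In the ball the truncation is inactive and the local expansion applies; outside it, all three
    -- terms are bounded crudely by `K₃ G²`.
    by_cases hzη : ‖z‖ < η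
    · have hmem : (z, (n : ℝ)⁻¹) ∈ Metric.ball (0 : (Fin r × Fin c → ℝ) × ℝ) η₁ := by
        rw [mem_ball_zero_iff, Prod.norm_def, max_lt_iff]
        refine ⟨hzη.trans_le hηη₁, ?_⟩
        rw [Real.norm_of_nonneg (by positivity)]
        exact hni.trans_le hηη₁
      have := hb₁ _ hmem
      rw [if_pos hzη, if_pos (hzη.trans_le hηη₀), posteriorMean_eq hn hα hx]
      rw [Real.norm_eq_abs, Real.norm_of_nonneg (by positivity)] at this
      refine le_of_eq_of_le ?_ (this.trans (le_of_eq ?_))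
      · congr 1
        ring
      · rw [abs_of_nonneg (by positivity)]
        ring
    · rw [if_neg hzη]
      have b1 : (f (posteriorMean α x) - f p) ^ 2 ≤ (1 + |f p|) ^ 2 * G ^ 2 := by
        rw [← mul_pow, ← sq_abs]
        refine pow_le_pow_left₀ (abs_nonneg _) ?_ 2
        refine (abs_sub _ _).trans ((add_le_add_left (hns x hx) _).trans ?_)
        nlinarith [abs_nonneg (f p)]
      have b2 : |M z (n : ℝ)⁻¹| ≤ |K₂| := by
        refine (hK₂ z _ (norm_deviation_le_one hp hx) ?_).trans (le_abs_self _)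
        rw [abs_of_nonneg (by positivity)]
        exact hni.le.trans hη1
      have b3 : |if ‖z‖ < η₀ then (f (p + z) - f p) ^ 2 else 0| ≤ 1 := by
        split_ifs with h
        · rw [abs_pow]
          exact pow_le_one₀ (abs_nonneg _) (hb₀ z h)
        · simp
      have hG2 : 1 ≤ G ^ 2 := one_le_pow₀ hG1
      have b4 : (|K₂| + 1) * 1 ≤ (|K₂| + 1) * G ^ 2 :=
        mul_le_mul_of_nonneg_left hG2 (by positivity)
      refine (abs_sub _ _).trans ?_
      rw [abs_of_nonneg (sq_nonneg (f (posteriorMean α x) - f p))]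
      have b5 := abs_add_le (M z (n : ℝ)⁻¹) (if ‖z‖ < η₀ then (f (p + z) - f p) ^ 2 else 0)
      have b6 : 0 ≤ ε * (n : ℝ)⁻¹ * ‖z‖ ^ 2 + ε * (n : ℝ)⁻¹ * (n : ℝ)⁻¹ := by positivity
      rw [hK₃]
      linarith
  refine (multinomialExp_mono hp.1 hpt).trans ?_
  rw [multinomialExp_add, multinomialExp_add, multinomialExp_const hp.2, multinomialExp_const_mul,
    multinomialExp_const_mul]
  have c1 : ε * (n : ℝ)⁻¹ * multinomialExp n p (fun x => ‖deviation n p x‖ ^ 2) ≤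
      ε * (n : ℝ)⁻¹ * ((n : ℝ)⁻¹ * K) :=
    mul_le_mul_of_nonneg_left ((multinomialExp_norm_sq_le hp hn).trans
      (mul_le_mul_of_nonneg_left (le_abs_self _) (by positivity))) (by positivity)
  have c2 : K₃ * G ^ 2 * multinomialExp n p (fun x => if ‖deviation n p x‖ < η then 0 else 1) ≤
      K₃ * G ^ 2 * (2 * Fintype.card (Fin r × Fin c) * Real.exp (-(η ^ 2 / 4) * n)) :=
    mul_le_mul_of_nonneg_left (multinomialExp_tail hp hn hηpos hη1) (by positivity)
  have c3 : G ^ 2 * Real.exp (-(η ^ 2 / 4) * n) = Real.exp (-(η ^ 2 / 8) * n) := by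
    rw [hG, ← Real.exp_nat_mul, ← Real.exp_add]
    congr 1
    push_cast
    ring
  have c4 : ε * (n : ℝ)⁻¹ * ((n : ℝ)⁻¹ * K) + ε * (n : ℝ)⁻¹ * (n : ℝ)⁻¹ =
      C / 2 * (1 / (n : ℝ) ^ 2) := by
    have hK1 : K + 1 ≠ 0 := by positivity
    rw [hε]
    field_simp
  have c5 : K₃ * G ^ 2 * (2 * Fintype.card (Fin r × Fin c) * Real.exp (-(η ^ 2 / 4) * n)) =
      K₃ * (2 * Fintype.card (Fin r × Fin c)) * Real.exp (-(η ^ 2 / 8) * n) := by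
    rw [← c3]
    ring
  linarith [Real.exp_pos (-(η ^ 2 / 8) * n)]
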